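/- Let $M^n \subset \mathbb{R}^N$ be a smooth embedded $n$-dimensional submanifold without boundary which is closed as a subset of $\mathbb{R}^N$ (for instance, any compact one). For $p\in\mathbb{R}^N$ put $d(p,M)=\inf_{x\in M}|p-x|$ and $\pi_M(p)=\{x\in M : |p-x|=d(p,M)\}$; for $r\in[0,\infty]$ put $U^r_M=\{p\in\mathbb{R}^N : d(p,M)<r\}$. Let $$\tau=\sup\{r\ge 0 : |\pi_M(p)|=1 \text{ for all } p\in U^r_M\}\in[0,\infty]$$ be the reach of $M$. Let $NM=\{(x,v) : x\in M,\ v\in (T_xM)^\perp\subset\mathbb{R}^N\}$ be the normal bundle of $M$, and $$V^\tau=\{(x,v)\in NM : |v|<\tau\}.$$ Then $V^\tau$ is a smooth embedded $N$-dimensional submanifold of $\mathbb{R}^N\times\mathbb{R}^N$, and, for its smooth structure as such, the endpoint map $$E: V^\tau\to U^\tau_M,\qquad (x,v)\mapsto x+v,$$ is a ($C^\infty$) diffeomorphism onto the open set $U^\tau_M$. -/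

import Mathlib

open scoped Manifold ContDiff ENNReal NNReal

noncomputable section

namespace QuantTube

/-- A subset `S` of a normed space `F`, carrying an atlas with charts in `ℝ^d`, is a smooth embedded
submanifold (without boundary) of dimension `d`: the atlas (on the subspace topology) is smooth, and
the inclusion `S → F` is a smooth embedding, that is, a smooth immersion and a topological
embedding. -/
structure IsEmbeddedSubmanifold {F : Type*} [NormedAddCommGroup F] [NormedSpace ℝ F] (d : ℕ)
    (S : Set F) [ChartedSpace (EuclideanSpace ℝ (Fin d)) S] : Prop where
  isManifold : IsManifold (𝓡 d) ∞ S
  isSmoothEmbedding : Manifold.IsSmoothEmbedding (𝓡 d) 𝓘(ℝ, F) ∞ (Subtype.val : S → F)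

variable {N : ℕ}

/-- The set of points of `M` nearest to `p`. -/
def nearestPoints (M : Set (EuclideanSpace ℝ (Fin N))) (p : EuclideanSpace ℝ (Fin N)) :
    Set (EuclideanSpace ℝ (Fin N)) :=
  {x | x ∈ M ∧ edist p x = Metric.infEDist p M}

/-- The open set of points at distance less than `r` from `M` (here `r` may be infinite, and the
distance to the empty set is infinite). -/
def tube (M : Set (EuclideanSpace ℝ (Fin N))) (r : ℝ≥0∞) :
    TopologicalSpace.Opens (EuclideanSpace ℝ (Fin N)) where
  carrier := {p | Metric.infEDist p M < r}
  is_open' := isOpen_lt Metric.continuous_infEDist continuous_const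

/-- The reach of `M`: the supremum in `[0, ∞]` of the radii `0 ≤ r < ∞` for which every point at
distance less than `r` from `M` has exactly one nearest point on `M`. -/
def reach (M : Set (EuclideanSpace ℝ (Fin N))) : ℝ≥0∞ :=
  ⨆ (r : ℝ≥0) (_ : ∀ p ∈ tube M r, (nearestPoints M p).encard = 1), (r : ℝ≥0∞)

/-- The tangent space `T_x M` as a subspace of `ℝ^N`: the range of the derivative of the
inclusion. -/
def tangentSubspace (n : ℕ) (M : Set (EuclideanSpace ℝ (Fin N)))
    [ChartedSpace (EuclideanSpace ℝ (Fin n)) M] (x : M) :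
    Submodule ℝ (EuclideanSpace ℝ (Fin N)) :=
  LinearMap.range (mfderiv (𝓡 n) (𝓡 N) (Subtype.val : M → EuclideanSpace ℝ (Fin N)) x :
    EuclideanSpace ℝ (Fin n) →L[ℝ] EuclideanSpace ℝ (Fin N)).toLinearMap

/-- The normal bundle `NM = {(x, v) : x ∈ M, v ⟂ T_x M}`, as a subset of `ℝ^N × ℝ^N`. -/
def normalBundle (n : ℕ) (M : Set (EuclideanSpace ℝ (Fin N)))
    [ChartedSpace (EuclideanSpace ℝ (Fin n)) M] :
    Set (EuclideanSpace ℝ (Fin N) × EuclideanSpace ℝ (Fin N)) :=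
  {q | ∃ h : q.1 ∈ M, q.2 ∈ (tangentSubspace n M ⟨q.1, h⟩)ᗮ}

/-- The normal vectors of length less than `r`. -/
def normalDisc (n : ℕ) (M : Set (EuclideanSpace ℝ (Fin N)))
    [ChartedSpace (EuclideanSpace ℝ (Fin n)) M] (r : ℝ≥0∞) :
    Set (EuclideanSpace ℝ (Fin N) × EuclideanSpace ℝ (Fin N)) :=
  {q | q ∈ normalBundle n M ∧ ‖q.2‖ₑ < r}

theorem add_mem_tube {n : ℕ} {M : Set (EuclideanSpace ℝ (Fin N))}
    [ChartedSpace (EuclideanSpace ℝ (Fin n)) M] {r : ℝ≥0∞}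
    {q : EuclideanSpace ℝ (Fin N) × EuclideanSpace ℝ (Fin N)} (hq : q ∈ normalDisc n M r) :
    q.1 + q.2 ∈ tube M r := by
  obtain ⟨⟨hx, -⟩, hv⟩ := hq
  refine lt_of_le_of_lt (Metric.infEDist_le_edist_of_mem hx) ?_
  simpa [edist_eq_enorm_sub] using hv

/-- The endpoint map `(x, v) ↦ x + v`, from the normal vectors of length less than `r` to the
`r`-neighbourhood of `M`. -/
def endpointMap (n : ℕ) (M : Set (EuclideanSpace ℝ (Fin N)))
    [ChartedSpace (EuclideanSpace ℝ (Fin n)) M] (r : ℝ≥0∞) (q : normalDisc n M r) : tube M r :=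
  ⟨q.1.1 + q.1.2, add_mem_tube q.2⟩

end QuantTube

end

/-! The inverse of the endpoint map is `p ↦ (π p, p - π p)`, with `π` the nearest-point projection,
and everything reduces to properties of `π` on the tube of radius `reach M`.

Minimality makes `p - π p` normal. Conversely, a normal vector `v` at `x` shorter than the reach
satisfies `π (x + v) = x`. For `s • v` with `s` small this holds because `M` leaves its tangent
space only quadratically (`IsLocalParam.exists_infDist_add_smul`). The set of `s` with `infDist (x +
s • v) M = s * ‖v‖` is closed, and it can be continued along the ray by maximizing the distance to
`M` over a small ball (`IsNearestPointProj.infDist_extend`). That argument needs only continuity of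
`π`, not differentiability of the distance.

For smoothness at `x + v`, the ray is continued slightly past `x + v`, which is possible because
`‖v‖` is strictly below the reach. Hence the squared distance to `x + v` grows quadratically along
`M` at `x`, its Hessian in a parametrization is nondegenerate, and the implicit function theorem
yields `π` (`IsLocalParam.contDiffAt_proj`).

The inverse, being smooth on the tube, also straightens the disc bundle to `E × {0}` inside `E × E`,
so the disc bundle is a submanifold. -/

namespace QuantTube

open Metric Filter Set Asymptotics
open scoped Topology RealInnerProductSpace

/-! ### Nearest-point projections and continuation along rays -/

section Metric

variable {E : Type*} [NormedAddCommGroup E] {M : Set E} {π : E → E} {U : Set E}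

/-- `π` is a nearest-point projection onto `M`, uniquely determined on `U`. -/
structure IsNearestPointProj (M : Set E) (U : Set E) (π : E → E) : Prop where
  mem : ∀ p, π p ∈ M
  dist_eq : ∀ p, dist p (π p) = infDist p M
  eq_of_dist_eq : ∀ p ∈ U, ∀ y ∈ M, dist p y = infDist p M → y = π p

/-- Near `q` the values of `π` stay in a compact part of `M`, and any cluster point of them is a
nearest point of `q`. Uniqueness leaves only `π q`. -/
theorem IsNearestPointProj.continuousAt [ProperSpace E] (h : IsNearestPointProj M U π)
    (hM : IsClosed M) {q : E} (hq : q ∈ U) : ContinuousAt π q := by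
  have hK : IsCompact (closedBall q (infDist q M + 2) ∩ M) :=
    (isCompact_closedBall _ _).inter_right hM
  have hd : Continuous fun p => infDist p M := continuous_infDist_pt M
  refine hK.tendsto_nhds_of_unique_mapClusterPt ?_ ?_
  · have h1 : ∀ᶠ p in 𝓝 q, dist p q < 1 := ball_mem_nhds q one_pos
    have h2 : ∀ᶠ p in 𝓝 q, infDist p M < infDist q M + 1 :=
      hd.continuousAt.eventually (gt_mem_nhds (by linarith))
    filter_upwards [h1, h2] with p hp1 hp2
    refine ⟨?_, h.mem p⟩
    rw [mem_closedBall]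
    have := dist_triangle (π p) p q
    have := h.dist_eq p
    rw [dist_comm] at this
    linarith
  · intro y hy hcl
    refine h.eq_of_dist_eq q hq y hy.2 (le_antisymm ?_ (infDist_le_dist_of_mem hy.2))
    refine le_of_forall_pos_le_add fun ε hε => ?_
    have h1 : ∀ᶠ p in 𝓝 q, dist p q < ε / 3 := ball_mem_nhds q (by positivity)
    have h2 : ∀ᶠ p in 𝓝 q, infDist p M < infDist q M + ε / 3 :=
      hd.continuousAt.eventually (gt_mem_nhds (by linarith))
    have h3 : ∃ᶠ p in 𝓝 q, dist (π p) y < ε / 3 :=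
      hcl.frequently (ball_mem_nhds y (by positivity))
    obtain ⟨p, hp3, hp1, hp2⟩ := (h3.and_eventually (h1.and h2)).exists
    have t1 := dist_triangle4 q p (π p) y
    rw [h.dist_eq p, dist_comm q p] at t1
    linarith

variable [InnerProductSpace ℝ E]

/-- A point of a closed ball around `q` at maximal distance from `M` lies on the boundary sphere,
in the direction pointing away from its nearest point on `M`. -/
theorem IsNearestPointProj.eq_of_isMaxOn [ProperSpace E] (h : IsNearestPointProj M U π)
    (hM : IsClosed M) {p q : E} {ε : ℝ} (hε : 0 < ε) (hpU : p ∈ U)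
    (hp : p ∈ closedBall q ε) (hmax : IsMaxOn (fun z => infDist z M) (closedBall q ε) p)
    (hpos : 0 < infDist p M) : p = q + (ε / ‖p - π p‖) • (p - π p) := by
  set w := p - π p with hw
  have hwn : ‖w‖ = infDist p M := by rw [hw, ← dist_eq_norm, h.dist_eq]
  have hw0 : 0 < ‖w‖ := hwn ▸ hpos
  set p' := q + (ε / ‖w‖) • w with hp'
  by_contra hne
  set d := p' - p with hd
  -- `p'` is the only point of the ball maximizing `⟪·, w⟫`: the equality case of Cauchy–Schwarz.
  have hdw : 0 < ⟪d, w⟫ := by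
    have hpq : ‖p - q‖ ≤ ε := by simpa [dist_eq_norm] using hp
    have hd0 : 0 < ‖d‖ := norm_pos_iff.2 (sub_ne_zero.2 fun e => hne e.symm)
    have e1 : d = (ε / ‖w‖) • w - (p - q) := by rw [hd, hp']; abel
    have e2 : ‖d‖ ^ 2 = ε ^ 2 - 2 * (ε / ‖w‖) * ⟪w, p - q⟫ + ‖p - q‖ ^ 2 := by
      rw [e1, norm_sub_sq_real, norm_smul, inner_smul_left, Real.norm_eq_abs,
        abs_of_pos (by positivity), div_mul_cancel₀ _ hw0.ne']
      simp; ring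
    have e3 : ⟪d, w⟫ = ε * ‖w‖ - ⟪w, p - q⟫ := by
      rw [e1, inner_sub_left, inner_smul_left, real_inner_self_eq_norm_sq, real_inner_comm]
      simp; field_simp
    have e4 : 0 < ‖d‖ ^ 2 := by positivity
    have e5 : ‖p - q‖ ^ 2 ≤ ε ^ 2 := by gcongr
    have e6 : (ε / ‖w‖) * ⟪w, p - q⟫ < (ε / ‖w‖) * (ε * ‖w‖) := by
      have : (ε / ‖w‖) * (ε * ‖w‖) = ε ^ 2 := by field_simp
      nlinarith
    have := lt_of_mul_lt_mul_left e6 (by positivity)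
    rw [e3]; linarith
  have hp'mem : p' ∈ closedBall q ε := by
    simp [hp', dist_eq_norm, norm_smul, abs_of_pos hε, div_mul_cancel₀ _ hw0.ne']
  have hline : Tendsto (fun t : ℝ => p + t • d) (𝓝[>] 0) (𝓝 p) := by
    have : Continuous fun t : ℝ => p + t • d := by fun_prop
    have := this.tendsto 0
    simp only [zero_smul, add_zero] at this
    exact this.mono_left nhdsWithin_le_nhds
  -- Moving from `p` towards `p'` increases the distance: compare `p` and `p + t • d` with the same
  -- foot `π (p + t • d)`. Continuity of `π` keeps the inner product positive for small `t`.
  have hlim : Tendsto (fun t : ℝ => ⟪d, p - π (p + t • d)⟫) (𝓝[>] 0) (𝓝 ⟪d, w⟫) :=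
    tendsto_const_nhds.inner
      (tendsto_const_nhds.sub ((h.continuousAt hM hpU).tendsto.comp hline))
  have hev : ∀ᶠ t : ℝ in 𝓝[>] 0, 0 < ⟪d, p - π (p + t • d)⟫ := hlim.eventually (lt_mem_nhds hdw)
  have h01 : ∀ᶠ t : ℝ in 𝓝[>] 0, t ∈ Ioo (0 : ℝ) 1 := Ioo_mem_nhdsGT one_pos
  obtain ⟨t, ht, ht0, ht1⟩ := (hev.and h01).exists
  have hmem : p + t • d ∈ closedBall q ε := by
    have := (convex_closedBall q ε).add_smul_sub_mem hp hp'mem ⟨ht0.le, ht1.le⟩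
    simpa [hd] using this
  have hle : infDist (p + t • d) M ≤ infDist p M := hmax hmem
  set z := π (p + t • d) with hz
  have hzM : z ∈ M := h.mem _
  have h1 : infDist (p + t • d) M = ‖t • d + (p - z)‖ := by
    rw [← h.dist_eq, dist_eq_norm]; congr 1; abel
  have h2 : infDist p M ≤ ‖p - z‖ := by rw [← dist_eq_norm]; exact infDist_le_dist_of_mem hzM
  have h3 : ‖t • d + (p - z)‖ ^ 2 = ‖t • d‖ ^ 2 + 2 * (t * ⟪d, p - z⟫) + ‖p - z‖ ^ 2 := by
    rw [norm_add_sq_real, inner_smul_left]; simp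
  have h4 : 0 < t * ⟪d, p - z⟫ := by positivity
  have h5 : ‖t • d + (p - z)‖ ≤ ‖p - z‖ := by linarith
  have h6 : ‖t • d + (p - z)‖ ^ 2 ≤ ‖p - z‖ ^ 2 := by gcongr
  nlinarith [sq_nonneg ‖t • d‖]

/-- Distance from `M` keeps growing at unit speed along the ray from a nearest point. -/
theorem IsNearestPointProj.infDist_extend [ProperSpace E] (h : IsNearestPointProj M U π)
    (hM : IsClosed M) {q x : E} {ε : ℝ} (hε : 0 < ε) (hball : closedBall q ε ⊆ U) (hx : x ∈ M)
    (hqx : ‖q - x‖ = infDist q M) (hεd : ε < infDist q M) :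
    infDist (q + (ε / ‖q - x‖) • (q - x)) M = ‖q - x‖ + ε := by
  obtain ⟨p, hp, hmax⟩ := (isCompact_closedBall q ε).exists_isMaxOn
    ⟨q, mem_closedBall_self hε.le⟩ (continuous_infDist_pt M).continuousOn
  have hqp : infDist q M ≤ infDist p M := hmax (mem_closedBall_self hε.le)
  have hp0 : 0 < infDist p M := by linarith
  have hpe := h.eq_of_isMaxOn hM hε (hball hp) hp hmax hp0
  have hwn : ‖p - π p‖ = infDist p M := by rw [← dist_eq_norm, h.dist_eq]
  set w := p - π p with hw
  have hw0 : ‖w‖ ≠ 0 := by rw [hwn]; exact hp0.ne'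
  -- The centre `q` lies on the segment from `π p` to the maximizer `p`, so `π p` is also nearest to
  -- `q`. By uniqueness it is `x`, which puts `p` on the ray from `x` through `q`.
  have hqy : q - π p = (1 - ε / ‖w‖) • w := by
    have : q = p - (ε / ‖w‖) • w := eq_sub_of_add_eq hpe.symm
    rw [this, sub_smul, one_smul, hw]; abel
  have hεw : ε / ‖w‖ < 1 := (div_lt_one (by positivity)).2 (by linarith)
  have hqyn : ‖q - π p‖ = ‖w‖ - ε := by
    rw [hqy, norm_smul, Real.norm_eq_abs, abs_of_pos (by linarith), sub_mul, one_mul,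
      div_mul_cancel₀ _ hw0]
  have hqd : infDist q M = ‖w‖ - ε := by
    refine le_antisymm (hqyn ▸ dist_eq_norm q (π p) ▸ infDist_le_dist_of_mem (h.mem p)) ?_
    have := infDist_le_infDist_add_dist (s := M) (x := p) (y := q)
    rw [mem_closedBall] at hp
    linarith
  have hqU : q ∈ U := hball (mem_closedBall_self hε.le)
  have hxy : x = π p := by
    rw [h.eq_of_dist_eq q hqU x hx (by rw [dist_eq_norm, hqx]),
      ← h.eq_of_dist_eq q hqU (π p) (h.mem p) (by rw [dist_eq_norm, hqyn, hqd])]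
  have : q + (ε / ‖q - x‖) • (q - x) = p := by
    rw [hpe, hxy, hqyn, hqy, smul_smul]
    congr 2
    have : ‖w‖ - ε ≠ 0 := by linarith
    field_simp
  rw [this, hqx, ← hwn, hqd]; ring

theorem infDist_add_smul_le {x : E} (hx : x ∈ M) (v : E) {s : ℝ} (hs : 0 ≤ s) :
    infDist (x + s • v) M ≤ s * ‖v‖ := by
  refine (infDist_le_dist_of_mem hx).trans ?_
  simp [dist_eq_norm, norm_smul, abs_of_nonneg hs]

/-- The distance to `M` is 1-Lipschitz, so it cannot fall short earlier on the ray and catch up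
later. -/
theorem infDist_add_smul_of_le {x v : E} (hx : x ∈ M) {s s' : ℝ} (hs' : 0 ≤ s') (h : s' ≤ s)
    (hs : infDist (x + s • v) M = s * ‖v‖) : infDist (x + s' • v) M = s' * ‖v‖ := by
  refine le_antisymm (infDist_add_smul_le hx v hs') ?_
  have := infDist_le_infDist_add_dist (s := M) (x := x + s • v) (y := x + s' • v)
  rw [hs, dist_add_left, dist_eq_norm, ← sub_smul, norm_smul, Real.norm_eq_abs,
    abs_of_nonneg (by linarith)] at this
  linarith

/-- If a segment starting at `x ∈ M` lies in `U` and `x` is a nearest point of some point of the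
open segment, then `x` is a nearest point of the endpoint. -/
theorem IsNearestPointProj.infDist_add_eq_norm [ProperSpace E] (h : IsNearestPointProj M U π)
    (hM : IsClosed M) (hU : IsOpen U) {x v : E} (hx : x ∈ M)
    (hseg : ∀ s ∈ Icc (0 : ℝ) 1, x + s • v ∈ U)
    (hstart : ∃ s > 0, infDist (x + s • v) M = s * ‖v‖) : infDist (x + v) M = ‖v‖ := by
  rcases eq_or_ne v 0 with rfl | hv
  · simpa using infDist_zero_of_mem hx
  have hv0 : 0 < ‖v‖ := norm_pos_iff.2 hv
  set T : Set ℝ := {s | infDist (x + s • v) M = s * ‖v‖} with hT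
  have hTc : IsClosed T := isClosed_eq
    ((continuous_infDist_pt M).comp (by fun_prop : Continuous fun s : ℝ => x + s • v))
    (by fun_prop)
  have hsub : Icc (0 : ℝ) 1 ⊆ T := by
    refine (hTc.inter isClosed_Icc).Icc_subset_of_forall_exists_gt ?_ ?_
    · simpa [hT] using infDist_zero_of_mem hx
    rintro s ⟨hsT, hs0, hs1⟩ y (hy : s < y)
    rcases hs0.eq_or_lt with rfl | hs0
    · obtain ⟨t, ht0, ht⟩ := hstart
      exact ⟨min t y, infDist_add_smul_of_le hx (le_min ht0.le hy.le) (min_le_left _ _) ht,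
        lt_min ht0 hy, min_le_right _ _⟩
    set q := x + s • v with hq
    have hqx : q - x = s • v := by simp [hq]
    have hqn : ‖q - x‖ = s * ‖v‖ := by rw [hqx, norm_smul, Real.norm_eq_abs, abs_of_pos hs0]
    obtain ⟨δ, hδ, hball⟩ := Metric.isOpen_iff.1 hU q (hseg s ⟨hs0.le, hs1.le⟩)
    have hsv : 0 < s * ‖v‖ := by positivity
    have hyv : 0 < (y - s) * ‖v‖ := mul_pos (by linarith) hv0
    -- The three bounds keep the ball in `U`, keep `ε` below the distance from `q` to `M`, and keep
    -- the new parameter below `y`.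
    obtain ⟨ε, hε0, hε⟩ : ∃ ε > 0, ε < min δ (min (s * ‖v‖) ((y - s) * ‖v‖)) :=
      exists_between (lt_min hδ (lt_min hsv hyv))
    have hεδ := hε.trans_le (min_le_left _ _)
    have hεs := (hε.trans_le (min_le_right _ _)).trans_le (min_le_left _ _)
    have hεy := (hε.trans_le (min_le_right _ _)).trans_le (min_le_right _ _)
    have key := h.infDist_extend hM hε0 ((closedBall_subset_ball hεδ).trans hball) hx
      (hqn.trans hsT.symm) (hεs.trans_eq hsT.symm)
    have e : q + (ε / ‖q - x‖) • (q - x) = x + (s + ε / ‖v‖) • v := by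
      rw [hqn, hqx, smul_smul, hq, add_smul, add_assoc]
      congr 3
      field_simp
    rw [e, hqn] at key
    refine ⟨s + ε / ‖v‖, ?_, ?_, ?_⟩
    · change infDist _ M = _
      rw [key, add_mul, div_mul_cancel₀ _ hv0.ne']
    · have : 0 < ε / ‖v‖ := by positivity
      linarith
    · have : ε / ‖v‖ < y - s := (div_lt_iff₀ hv0).2 hεy
      linarith
  simpa [hT] using hsub (right_mem_Icc.2 zero_le_one)

end Metric
-- Second-order estimates at critical points
section Calculus

variable {G : Type*} [NormedAddCommGroup G] [NormedSpace ℝ G]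

/-- A function with a critical point at `a` and a derivative that is `O(‖b - a‖)` varies by
`O(‖b - a‖ ^ 2)`. -/
theorem isBigO_sub_of_hasFDerivAt {k : G → ℝ} {k' : G → G →L[ℝ] ℝ} {a : G}
    (hk : ∀ᶠ b in 𝓝 a, HasFDerivAt k (k' b) b) (hO : k' =O[𝓝 a] fun b => b - a) :
    (fun b => k b - k a) =O[𝓝 a] fun b => ‖b - a‖ ^ 2 := by
  obtain ⟨C, hC⟩ := hO.bound
  obtain ⟨δ, hδ, hball⟩ := Metric.eventually_nhds_iff_ball.1 (hk.and hC)
  refine IsBigO.of_bound C ?_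
  filter_upwards [ball_mem_nhds a hδ] with b hb
  have hsub : closedBall a ‖b - a‖ ⊆ ball a δ :=
    closedBall_subset_ball (by simpa [dist_eq_norm] using hb)
  have hC0 : 0 ≤ C ∨ b = a := by
    rcases eq_or_ne b a with h | h
    · exact .inr h
    · refine .inl (nonneg_of_mul_nonneg_left ((norm_nonneg _).trans (hball b hb).2) ?_)
      exact norm_pos_iff.2 (sub_ne_zero.2 h)
  rcases hC0 with hC0 | rfl
  · have := (convex_closedBall a ‖b - a‖).norm_image_sub_le_of_norm_hasFDerivWithin_le
      (f := k) (f' := k') (C := C * ‖b - a‖)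
      (fun z hz => (hball z (hsub hz)).1.hasFDerivWithinAt)
      (fun z hz => (hball z (hsub hz)).2.trans
        (mul_le_mul_of_nonneg_left (by simpa [dist_eq_norm] using hz) hC0))
      (mem_closedBall_self (norm_nonneg _)) (y := b) (by simp [dist_eq_norm])
    refine this.trans_eq ?_
    simp; ring
  · simp

/-- At a minimum with quadratic growth the second derivative is injective. -/
theorem eq_zero_of_quadratic_growth {k : G → ℝ} {k' : G → G →L[ℝ] ℝ} {H : G →L[ℝ] G →L[ℝ] ℝ}
    {a : G} {c : ℝ} (hc : 0 < c) (hk : ∀ᶠ b in 𝓝 a, HasFDerivAt k (k' b) b) (hka : k' a = 0)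
    (hH : HasFDerivAt k' H a) (hgrow : ∀ᶠ b in 𝓝 a, c * ‖b - a‖ ^ 2 ≤ k b - k a) {u : G}
    (hu : H u = 0) : u = 0 := by
  by_contra hne
  have hu0 : 0 < ‖u‖ := norm_pos_iff.2 hne
  have hlin : HasDerivAt (fun t : ℝ => k' (a + t • u)) 0 0 := by
    have h1 : HasDerivAt (fun t : ℝ => a + t • u) u 0 := by
      simpa using ((hasDerivAt_id (0 : ℝ)).smul_const u).const_add a
    have h2 : HasFDerivAt k' H (a + (0 : ℝ) • u) := by simpa using hH
    have h3 := h2.comp_hasDerivAt (0 : ℝ) h1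
    rwa [hu] at h3
  -- If `H u = 0`, the derivative along `u` is `o(t)`. With this constant the mean value inequality
  -- bounds the increment by `c / 2 * (t * ‖u‖) ^ 2`, half of the assumed growth.
  have hsmall : ∀ᶠ t : ℝ in 𝓝 0, ‖k' (a + t • u)‖ ≤ c * ‖u‖ / 2 * ‖t‖ := by
    have := hlin.isLittleO.def (show 0 < c * ‖u‖ / 2 by positivity)
    simpa [hka] using this
  have hcont : Tendsto (fun t : ℝ => a + t • u) (𝓝 0) (𝓝 a) := by
    have : Continuous fun t : ℝ => a + t • u := by fun_prop
    simpa using this.tendsto 0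
  obtain ⟨δ, hδ, hball⟩ := Metric.eventually_nhds_iff_ball.1
    (hsmall.and ((hcont.eventually hk).and (hcont.eventually hgrow)))
  set t := δ / 2 with ht
  have ht0 : 0 < t := by positivity
  have hmem : ∀ s ∈ Icc 0 t, s ∈ ball (0 : ℝ) δ := fun s hs => by
    rw [mem_ball, dist_zero_right, Real.norm_eq_abs, abs_of_nonneg hs.1]
    linarith [hs.2]
  have := (convex_Icc 0 t).norm_image_sub_le_of_norm_hasDerivWithin_le
    (f := fun s : ℝ => k (a + s • u)) (f' := fun s => k' (a + s • u) u)
    (C := c * ‖u‖ / 2 * t * ‖u‖) (fun s hs => by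
      have h1 : HasDerivAt (fun t : ℝ => a + t • u) u s := by
        simpa using ((hasDerivAt_id s).smul_const u).const_add a
      exact ((hball s (hmem s hs)).2.1.comp_hasDerivAt s h1).hasDerivWithinAt)
    (fun s hs => by
      refine (ContinuousLinearMap.le_opNorm _ _).trans ?_
      gcongr
      refine (hball s (hmem s hs)).1.trans ?_
      gcongr
      rw [Real.norm_eq_abs, abs_of_nonneg hs.1]
      exact hs.2) (left_mem_Icc.2 ht0.le) (right_mem_Icc.2 ht0.le)
  have h2 := (hball t (hmem t (right_mem_Icc.2 ht0.le))).2.2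
  simp only [zero_smul, add_zero, sub_zero, add_sub_cancel_left, norm_smul, Real.norm_eq_abs,
    abs_of_pos ht0] at this h2
  have h3 := (le_abs_self _).trans this
  have h4 : 0 < c * (t * ‖u‖) ^ 2 := by positivity
  nlinarith

/-- `G` and its dual have the same finite dimension, so injectivity suffices. -/
theorem _root_.ContinuousLinearMap.isInvertible_of_injective_dual [FiniteDimensional ℝ G]
    (H : G →L[ℝ] G →L[ℝ] ℝ) (hH : ∀ u, H u = 0 → u = 0) : H.IsInvertible := by
  have hinj : Function.Injective H.toLinearMap :=
    (injective_iff_map_eq_zero H.toLinearMap).2 hH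
  have hfin : Module.finrank ℝ G = Module.finrank ℝ (G →L[ℝ] ℝ) := by
    rw [← (LinearMap.toContinuousLinearMap (𝕜 := ℝ) (E := G) (F' := ℝ)).finrank_eq]
    exact Subspace.dual_finrank_eq.symm
  exact ⟨(LinearEquiv.ofInjectiveOfFinrankEq H.toLinearMap hinj hfin).toContinuousLinearEquiv, by
    ext; rfl⟩

end Calculus

/-! ### Local parametrizations and smoothness of the projection -/

section LocalParam

variable {E G : Type*} [NormedAddCommGroup E] [InnerProductSpace ℝ E]
  [NormedAddCommGroup G] [NormedSpace ℝ G] {M : Set E} {f : G → E} {a : G}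

/-- `f` is a smooth immersive parametrization of a neighbourhood of `f a` in `M`. -/
structure IsLocalParam (M : Set E) (f : G → E) (a : G) : Prop where
  contDiffAt : ContDiffAt ℝ ∞ f a
  injective : Function.Injective (fderiv ℝ f a)
  map_nhds : map f (𝓝 a) = 𝓝[M] (f a)

namespace IsLocalParam

theorem tendsto (h : IsLocalParam M f a) : Tendsto f (𝓝 a) (𝓝[M] (f a)) := h.map_nhds.le

theorem mem (h : IsLocalParam M f a) : f a ∈ M := by
  have : ∀ᶠ b in 𝓝 a, f b ∈ M := h.tendsto.eventually self_mem_nhdsWithin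
  exact this.self_of_nhds

theorem hasFDerivAt (h : IsLocalParam M f a) : ∀ᶠ b in 𝓝 a, HasFDerivAt f (fderiv ℝ f b) b := by
  have : ContDiffAt ℝ 1 f a := h.contDiffAt.of_le (by exact_mod_cast le_top)
  filter_upwards [this.eventually (by simp)] with b hb
  exact (hb.differentiableAt (by simp)).hasFDerivAt

theorem contDiffAt_fderiv (h : IsLocalParam M f a) : ContDiffAt ℝ ∞ (fderiv ℝ f) a :=
  h.contDiffAt.fderiv_right (by simp)

theorem hasFDerivAt_norm_sub_sq (h : IsLocalParam M f a) (p : E) :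
    ∀ᶠ b in 𝓝 a, HasFDerivAt (fun b => ‖f b - p‖ ^ 2)
      (2 • (innerSL ℝ (f b - p)).comp (fderiv ℝ f b)) b := by
  filter_upwards [h.hasFDerivAt] with b hb
  exact (hb.sub_const p).norm_sq

/-- The parametrization is bounded below by the parameter near the base point. -/
theorem isBigO_sub_rev [FiniteDimensional ℝ G] (h : IsLocalParam M f a) :
    (fun b => b - a) =O[𝓝 a] fun b => f b - f a := by
  have hind : Topology.IsInducing (fderiv ℝ f a) :=
    (LinearMap.isClosedEmbedding_of_injective (f := (fderiv ℝ f a).toLinearMap)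
      (LinearMap.ker_eq_bot.2 h.injective)).isInducing
  exact (h.hasFDerivAt.self_of_nhds.isTheta_sub hind).isBigO_symm

/-- If `f b` is a nearest point of `p` on `M` then `f b - p` is orthogonal to the tangent space. -/
theorem inner_fderiv_eq_zero (h : IsLocalParam M f a) :
    ∀ᶠ b in 𝓝 a, ∀ p, (∀ y ∈ M, ‖f b - p‖ ≤ ‖y - p‖) →
      (innerSL ℝ (f b - p)).comp (fderiv ℝ f b) = 0 := by
  have hM : ∀ᶠ b in 𝓝 a, f b ∈ M := h.tendsto.eventually self_mem_nhdsWithin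
  filter_upwards [h.hasFDerivAt, hM.eventually_nhds] with b hb hMb p hp
  have hmin : IsLocalMin (fun b => ‖f b - p‖ ^ 2) b := by
    filter_upwards [hMb] with z hz
    have := hp _ hz
    gcongr
  have := hmin.hasFDerivAt_eq_zero (hb.sub_const p).norm_sq
  rw [two_smul] at this
  ext u
  have hu := congr($this u)
  simp only [_root_.add_apply, _root_.zero_apply] at hu ⊢
  linarith

/-- Near `f a`, the manifold deviates from a direction normal to it at most quadratically. -/
theorem isBigO_inner_sub [FiniteDimensional ℝ G] (h : IsLocalParam M f a) {v : E}
    (hv : ∀ u, ⟪fderiv ℝ f a u, v⟫ = 0) :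
    (fun y => ⟪y - f a, v⟫) =O[𝓝[M] (f a)] fun y => ‖y - f a‖ ^ 2 := by
  rw [← h.map_nhds, isBigO_map]
  have hd : ∀ᶠ b in 𝓝 a, HasFDerivAt (fun b => ⟪v, f b⟫) ((innerSL ℝ v).comp (fderiv ℝ f b)) b := by
    filter_upwards [h.hasFDerivAt] with b hb
    exact (innerSL ℝ v).hasFDerivAt.comp b hb
  have hO : (fun b => (innerSL ℝ v).comp (fderiv ℝ f b)) =O[𝓝 a] fun b => b - a := by
    have h1 : DifferentiableAt ℝ (fun b => (innerSL ℝ v).comp (fderiv ℝ f b)) a :=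
      (differentiableAt_const _).clm_comp (h.contDiffAt_fderiv.differentiableAt (by simp))
    have h0 : (innerSL ℝ v).comp (fderiv ℝ f a) = 0 := by
      ext u
      simpa [real_inner_comm] using hv u
    simpa [h0] using h1.hasFDerivAt.isBigO_sub
  have h2 := isBigO_sub_of_hasFDerivAt hd hO
  have h3 := h2.trans ((h.isBigO_sub_rev.norm_norm).pow 2)
  refine h3.congr_left fun b => ?_
  simp [Function.comp, inner_sub_right, real_inner_comm v]

/-- Small normal displacements realize the distance to `M`. -/
theorem exists_infDist_add_smul [FiniteDimensional ℝ G] (h : IsLocalParam M f a) {v : E}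
    (hv : ∀ u, ⟪fderiv ℝ f a u, v⟫ = 0) : ∃ s > 0, infDist (f a + s • v) M = s * ‖v‖ := by
  obtain ⟨C, hC0, hC⟩ := (h.isBigO_inner_sub hv).exists_pos
  obtain ⟨δ, hδ, hball⟩ := Metric.mem_nhdsWithin_iff.1 hC.bound
  -- The first bound lets `‖y - f a‖ ^ 2` absorb the cross term for `y` within `δ` of `f a`; the
  -- second makes points farther away lose by the triangle inequality.
  obtain ⟨s, hs0, hs⟩ : ∃ s > 0, s < min (1 / (2 * C)) (δ / (2 * (‖v‖ + 1))) :=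
    exists_between (lt_min (by positivity) (by positivity))
  have hs1 : 2 * s * C ≤ 1 := by
    have := (lt_div_iff₀ (by positivity)).1 (hs.trans_le (min_le_left _ _))
    linarith
  have hs2 : 2 * (s * ‖v‖) ≤ δ := by
    have := (lt_div_iff₀ (by positivity)).1 (hs.trans_le (min_le_right _ _))
    nlinarith
  refine ⟨s, hs0, le_antisymm (infDist_add_smul_le h.mem v hs0.le) ?_⟩
  refine (le_infDist ⟨_, h.mem⟩).2 fun {y} hy => ?_
  have hsv : ‖s • v‖ = s * ‖v‖ := by rw [norm_smul, Real.norm_eq_abs, abs_of_pos hs0]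
  rw [dist_comm, dist_eq_norm, ← hsv,
    show y - (f a + s • v) = (y - f a) - s • v by abel]
  by_cases hyδ : y ∈ ball (f a) δ
  · have h1 : ⟪y - f a, v⟫ ≤ C * ‖‖y - f a‖ ^ 2‖ :=
      (le_abs_self _).trans (hball ⟨hyδ, hy⟩)
    rw [Real.norm_eq_abs, abs_of_nonneg (by positivity)] at h1
    refine le_of_sq_le_sq ?_ (norm_nonneg _)
    rw [norm_sub_sq_real (y - f a), inner_smul_right]
    nlinarith [sq_nonneg ‖y - f a‖]
  · have : δ ≤ ‖y - f a‖ := by simpa [dist_eq_norm] using hyδ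
    have := norm_sub_norm_le (y - f a) (s • v)
    linarith

end IsLocalParam

/-- If a point `x` of `M` is nearest to `x + s • v` for some `s > 1`, then the squared distance to
`x + v` grows quadratically along `M` away from `x`. -/
theorem sq_growth_of_infDist {x v : E} {s : ℝ} (hs : 1 < s)
    (hd : infDist (x + s • v) M = s * ‖v‖) {y : E} (hy : y ∈ M) :
    (1 - s⁻¹) * ‖y - x‖ ^ 2 ≤ ‖y - (x + v)‖ ^ 2 - ‖x - (x + v)‖ ^ 2 := by
  have hs0 : 0 < s := by linarith
  have h1 : s * ‖v‖ ≤ ‖(y - x) - s • v‖ := by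
    rw [← hd, show (y - x) - s • v = y - (x + s • v) by abel, ← dist_eq_norm, dist_comm]
    exact infDist_le_dist_of_mem hy
  have h2 : (s * ‖v‖) ^ 2 ≤ ‖(y - x) - s • v‖ ^ 2 := by gcongr
  rw [norm_sub_sq_real (y - x), norm_smul, inner_smul_right, Real.norm_eq_abs,
    abs_of_pos hs0] at h2
  rw [show y - (x + v) = (y - x) - v by abel, norm_sub_sq_real (y - x),
    show x - (x + v) = -v by abel, norm_neg]
  have h3 : 2 * ⟪y - x, v⟫ ≤ s⁻¹ * ‖y - x‖ ^ 2 := by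
    rw [inv_mul_eq_div, le_div_iff₀ hs0]; linarith
  linarith

variable {π : E → E} {U : Set E}

/-- The nearest-point projection is smooth at `f a + v` if `f a` is the nearest point of a point
beyond `f a + v` on the same ray. -/
theorem IsLocalParam.contDiffAt_proj [FiniteDimensional ℝ G] [FiniteDimensional ℝ E]
    (h : IsLocalParam M f a)
    (hπ : IsNearestPointProj M U π) (hM : IsClosed M) {v : E} {s : ℝ} (hs : 1 < s)
    (hd : infDist (f a + s • v) M = s * ‖v‖) (hU : f a + v ∈ U) (hπa : π (f a + v) = f a) :
    ContDiffAt ℝ ∞ π (f a + v) := by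
  set q := f a + v with hq
  -- `F (p, b)` is half the derivative in `b` of `‖f b - p‖ ^ 2`, so it vanishes when `f b` is
  -- nearest to `p`.
  set F : E × G → (G →L[ℝ] ℝ) := fun z => (innerSL ℝ (f z.2 - z.1)).comp (fderiv ℝ f z.2) with hF
  have hFs : ContDiffAt ℝ ∞ F (q, a) := by
    have h1 : ContDiffAt ℝ ∞ (fun z : E × G => f z.2) (q, a) :=
      ContDiffAt.comp (q, a) h.contDiffAt contDiffAt_snd
    have h2 : ContDiffAt ℝ ∞ (fun z : E × G => fderiv ℝ f z.2) (q, a) :=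
      ContDiffAt.comp (q, a) h.contDiffAt_fderiv contDiffAt_snd
    exact ((innerSL ℝ).contDiff.contDiffAt.comp (q, a) (h1.sub contDiffAt_fst)).clm_comp h2
  have hFd : HasFDerivAt F (fderiv ℝ F (q, a)) (q, a) :=
    (hFs.differentiableAt (by simp)).hasFDerivAt
  have hH : HasFDerivAt (fun b => F (q, b)) (fderiv ℝ F (q, a) ∘L .inr ℝ E G) a :=
    hFd.comp a (hasFDerivAt_prodMk_right q a)
  have hcrit : ∀ᶠ b in 𝓝 a, ∀ p, π p = f b → F (p, b) = 0 := by
    filter_upwards [h.inner_fderiv_eq_zero] with b hb p hp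
    refine hb p fun y hy => ?_
    rw [← hp, ← dist_eq_norm, ← dist_eq_norm, dist_comm, hπ.dist_eq, dist_comm]
    exact infDist_le_dist_of_mem hy
  have hFq : F (q, a) = 0 := hcrit.self_of_nhds q hπa
  have hs' : 0 < 1 - s⁻¹ := by
    have := inv_lt_one_of_one_lt₀ hs
    linarith
  have hinv : (fderiv ℝ F (q, a) ∘L .inr ℝ E G).IsInvertible := by
    refine ContinuousLinearMap.isInvertible_of_injective_dual _ fun u hu => ?_
    obtain ⟨C, hC0, hC⟩ := h.isBigO_sub_rev.exists_pos
    have hM' : ∀ᶠ b in 𝓝 a, f b ∈ M := h.tendsto.eventually self_mem_nhdsWithin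
    refine eq_zero_of_quadratic_growth (k := fun b => ‖f b - q‖ ^ 2)
      (k' := fun b => 2 • F (q, b)) (a := a) (c := (1 - s⁻¹) / C ^ 2)
      (H := 2 • (fderiv ℝ F (q, a) ∘L .inr ℝ E G)) (by positivity)
      (h.hasFDerivAt_norm_sub_sq q) (by simp [hFq]) (hH.const_smul 2) ?_ (by simp [hu])
    filter_upwards [hC.bound, hM'] with b hb hbM
    refine le_trans ?_ (sq_growth_of_infDist hs hd hbM)
    have : ‖b - a‖ ^ 2 ≤ (C * ‖f b - f a‖) ^ 2 := by gcongr
    rw [div_mul_eq_mul_div, div_le_iff₀ (by positivity)]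
    nlinarith
  have hψ := hFs.contDiffAt_implicitFunction (by simp) hinv
  set ψ := hFs.implicitFunction (by simp) hinv with hψdef
  have hψq : ψ q = a := hFs.implicitFunction_apply_self (by simp) hinv
  have hiff := hFs.eventually_apply_eq_iff_implicitFunction (by simp) hinv
  rw [hFq, nhds_prod_eq] at hiff
  obtain ⟨P, hP, W, hW, hPW⟩ := (eventually_prod_iff.1 hiff)
  -- The implicit function theorem is only local in `b`. Continuity of `π` places `π p = f b` with
  -- `b` in that neighbourhood, where `b = ψ p` is forced.
  have hπt : Tendsto π (𝓝 q) (𝓝[M] (f a)) :=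
    tendsto_nhdsWithin_iff.2 ⟨hπa ▸ hπ.continuousAt hM hU, Eventually.of_forall hπ.mem⟩
  have himg : ∀ᶠ p in 𝓝 q, π p ∈ f '' {b | W b ∧ ∀ p, π p = f b → F (p, b) = 0} := by
    refine hπt ?_
    rw [← h.map_nhds]
    exact image_mem_map (hW.and hcrit)
  have hev : π =ᶠ[𝓝 q] fun p => f (ψ p) := by
    filter_upwards [himg, hP] with p hp hpP
    obtain ⟨b, ⟨hbW, hb⟩, hbp⟩ := hp
    have : ψ p = b := (hPW hpP hbW).1 (hb p hbp.symm)
    rw [this, hbp]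
  refine ContDiffAt.congr_of_eventuallyEq ?_ hev
  have : ContDiffAt ℝ ∞ f (ψ q) := hψq ▸ h.contDiffAt
  exact this.comp q hψ

end LocalParam
-- Injectivity of the derivative of an immersion
section Immersion

variable {G E : Type*} [NormedAddCommGroup G] [NormedSpace ℝ G]
  [NormedAddCommGroup E] [NormedSpace ℝ E]

/-- An immersion has injective derivative. -/
theorem _root_.Manifold.IsImmersion.mfderiv_injective
    {X : Type*} [TopologicalSpace X] [ChartedSpace G X] [IsManifold 𝓘(ℝ, G) ∞ X] {f : X → E}
    (h : Manifold.IsImmersion 𝓘(ℝ, G) 𝓘(ℝ, E) ∞ f) (x : X) :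
    Function.Injective (mfderiv 𝓘(ℝ, G) 𝓘(ℝ, E) f x) := by
  have hx := h.isImmersionOfComplement_complement x
  set φ := hx.domChart
  set ψ := hx.codChart
  have hφx : x ∈ φ.source := hx.mem_domChart_source
  have hφ : ContMDiffAt 𝓘(ℝ, G) 𝓘(ℝ, G) ∞ φ.symm (φ x) :=
    contMDiffAt_symm_of_mem_maximalAtlas hx.domChart_mem_maximalAtlas (φ.map_source hφx)
  have hψ : ContMDiffAt 𝓘(ℝ, E) 𝓘(ℝ, E) ∞ ψ (f x) :=
    contMDiffAt_of_mem_maximalAtlas hx.codChart_mem_maximalAtlas hx.mem_codChart_source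
  -- In the normal form `u ↦ (u, 0)`, the first component gives a smooth local left inverse of `f`.
  have hr : ContMDiffAt 𝓘(ℝ, E) 𝓘(ℝ, G) ∞ (fun y => (hx.equiv.symm (ψ y)).1) (f x) := by
    have : ContDiff ℝ ∞ fun y => (hx.equiv.symm y).1 := by fun_prop
    exact this.contMDiff.contMDiffAt.comp (f x) hψ
  have hfst : (fun z => (hx.equiv.symm (ψ (f z))).1) =ᶠ[𝓝 x] φ := by
    filter_upwards [φ.open_source.mem_nhds hφx] with z hz
    have := hx.writtenInCharts
      (show φ z ∈ (φ.extend 𝓘(ℝ, G)).target by simpa using φ.map_source hz)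
    simp only [Function.comp_apply, mfld_simps] at this
    rw [φ.left_inv hz] at this
    simp [ψ, this]
  have hrx : (hx.equiv.symm (ψ (f x))).1 = φ x := hfst.self_of_nhds
  have hL : ContMDiffAt 𝓘(ℝ, E) 𝓘(ℝ, G) ∞ (fun y => φ.symm (hx.equiv.symm (ψ y)).1) (f x) :=
    ContMDiffAt.comp (f x) (g := φ.symm) (by rwa [hrx]) hr
  have hid : (fun y => φ.symm (hx.equiv.symm (ψ y)).1) ∘ f =ᶠ[𝓝 x] id := by
    filter_upwards [hfst, φ.open_source.mem_nhds hφx] with z hz hzs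
    simp only [Function.comp_apply, hz, φ.left_inv hzs, id]
  have hcomp := mfderiv_comp x (hL.mdifferentiableAt (by simp))
    (hx.contMDiffAt.mdifferentiableAt (by simp))
  rw [hid.mfderiv_eq, mfderiv_id] at hcomp
  intro u w huw
  have h1 := congr($hcomp u)
  have h2 := congr($hcomp w)
  simp only [ContinuousLinearMap.comp_apply, ContinuousLinearMap.id_apply] at h1 h2
  rw [huw] at h1
  exact h1.trans h2.symm

end Immersion

variable {n N : ℕ} {M : Set (EuclideanSpace ℝ (Fin N))}

/-! ### Charts of an embedded submanifold as local parametrizations -/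

section Submanifold

variable [ChartedSpace (EuclideanSpace ℝ (Fin n)) M]

theorem mfderiv_subtypeVal_eq (hM : IsEmbeddedSubmanifold n M) (x : M) :
    (mfderiv (𝓡 n) (𝓡 N) (Subtype.val : M → EuclideanSpace ℝ (Fin N)) x :
      EuclideanSpace ℝ (Fin n) →L[ℝ] EuclideanSpace ℝ (Fin N)) =
    fderiv ℝ (Subtype.val ∘ (chartAt (EuclideanSpace ℝ (Fin n)) x).symm)
      (chartAt (EuclideanSpace ℝ (Fin n)) x x) := by
  have := (hM.isSmoothEmbedding.contMDiff x).mdifferentiableAt (by simp)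
  rw [this.mfderiv]
  simp [writtenInExtChartAt, extChartAt, fderivWithin_univ, chartAt_self_eq, mfld_simps]
  rfl

/-- The inverse of a chart of an embedded submanifold is a local parametrization. -/
theorem IsEmbeddedSubmanifold.isLocalParam (hM : IsEmbeddedSubmanifold n M) (x : M) :
    IsLocalParam M (Subtype.val ∘ (chartAt (EuclideanSpace ℝ (Fin n)) x).symm)
      (chartAt (EuclideanSpace ℝ (Fin n)) x x) where
  contDiffAt := by
    have := (contMDiffAt_iff.1 (hM.isSmoothEmbedding.contMDiff x)).2
    simpa [extChartAt, chartAt_self_eq, mfld_simps, contDiffWithinAt_univ] using this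
  injective := by
    have := hM.isManifold
    rw [← mfderiv_subtypeVal_eq hM]
    exact hM.isSmoothEmbedding.isImmersion.mfderiv_injective x
  map_nhds := by
    have hx := mem_chart_source (EuclideanSpace ℝ (Fin n)) x
    rw [← Filter.map_map, OpenPartialHomeomorph.map_nhds_eq _ (OpenPartialHomeomorph.map_source _ hx),
      OpenPartialHomeomorph.left_inv _ hx, map_nhds_subtype_val]
    simp [OpenPartialHomeomorph.left_inv _ hx]

theorem mem_normalBundle_iff (hM : IsEmbeddedSubmanifold n M) (x : M)
    (v : EuclideanSpace ℝ (Fin N)) :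
    ((x : EuclideanSpace ℝ (Fin N)), v) ∈ normalBundle n M ↔
      ∀ u, ⟪fderiv ℝ (Subtype.val ∘ (chartAt (EuclideanSpace ℝ (Fin n)) x).symm)
        (chartAt (EuclideanSpace ℝ (Fin n)) x x) u, v⟫ = 0 := by
  have : ((x : EuclideanSpace ℝ (Fin N)), v) ∈ normalBundle n M ↔
      v ∈ (tangentSubspace n M x)ᗮ := ⟨fun ⟨_, h⟩ => h, fun h => ⟨x.2, h⟩⟩
  rw [this, Submodule.mem_orthogonal, tangentSubspace, mfderiv_subtypeVal_eq hM]
  exact ⟨fun h u => h _ ⟨u, rfl⟩, by rintro h _ ⟨u, rfl⟩; exact h u⟩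

/-- Every point of an embedded submanifold has a local parametrization whose derivative spans the
tangent space. -/
theorem IsEmbeddedSubmanifold.exists_isLocalParam (hM : IsEmbeddedSubmanifold n M)
    {x : EuclideanSpace ℝ (Fin N)} (hx : x ∈ M) :
    ∃ (f : EuclideanSpace ℝ (Fin n) → EuclideanSpace ℝ (Fin N)) (a : EuclideanSpace ℝ (Fin n)),
      IsLocalParam M f a ∧ f a = x ∧
      ∀ v, (x, v) ∈ normalBundle n M ↔ ∀ u, ⟪fderiv ℝ f a u, v⟫ = 0 :=
  ⟨_, _, hM.isLocalParam ⟨x, hx⟩, by simp, fun v => mem_normalBundle_iff hM ⟨x, hx⟩ v⟩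

end Submanifold

/-- Closedness provides a foot for every point. A point at distance strictly below the supremum
`reach M` lies in the tube of some admissible radius, whence uniqueness. -/
theorem exists_isNearestPointProj (hne : M.Nonempty) (hM : IsClosed M) :
    ∃ π, IsNearestPointProj M (tube M (reach M)) π := by
  choose π hπ using hM.exists_infDist_eq_dist hne
  have hiff : ∀ p y, y ∈ M → dist p y = infDist p M → y ∈ nearestPoints M p := by
    intro p y hy h
    refine ⟨hy, ?_⟩
    rw [edist_dist, h, infDist, ENNReal.ofReal_toReal (infEDist_ne_top hne)]
  refine ⟨π, fun p => (hπ p).1, fun p => (hπ p).2.symm, fun p hp y hy h => ?_⟩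
  have hp : infEDist p M < reach M := hp
  simp only [reach, lt_iSup_iff] at hp
  obtain ⟨r, hr, hpr⟩ := hp
  obtain ⟨z, hz⟩ := encard_eq_one.1 (hr p hpr)
  have h1 := hiff p y hy h
  have h2 := hiff p (π p) (hπ p).1 (hπ p).2.symm
  rw [hz, mem_singleton_iff] at h1 h2
  rw [h1, h2]

/-! ### The inverse of the endpoint map -/

section Endpoint

variable [ChartedSpace (EuclideanSpace ℝ (Fin n)) M]
  {π : EuclideanSpace ℝ (Fin N) → EuclideanSpace ℝ (Fin N)} {r : ℝ≥0∞}

theorem smul_mem_normalDisc {x v : EuclideanSpace ℝ (Fin N)} (h : (x, v) ∈ normalDisc n M r)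
    {s : ℝ} (hs : ‖s • v‖ₑ < r) : (x, s • v) ∈ normalDisc n M r := by
  obtain ⟨⟨hx, hv⟩, -⟩ := h
  exact ⟨⟨hx, Submodule.smul_mem _ s hv⟩, hs⟩

/-- The whole segment from `x` to `x + v` stays in the tube, so the equality known for short normal
vectors continues to its end. -/
theorem infDist_add_eq_norm_of_mem_normalDisc (hM : IsEmbeddedSubmanifold n M)
    (hclosed : IsClosed M) (hπ : IsNearestPointProj M (tube M r) π)
    {x v : EuclideanSpace ℝ (Fin N)} (h : (x, v) ∈ normalDisc n M r) :
    infDist (x + v) M = ‖v‖ := by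
  obtain ⟨hx, -⟩ := h.1
  refine hπ.infDist_add_eq_norm hclosed (tube M r).isOpen hx (fun s hs => ?_) ?_
  · refine add_mem_tube (q := (x, s • v)) (smul_mem_normalDisc h (lt_of_le_of_lt ?_ h.2))
    rw [← ofReal_norm, ← ofReal_norm, norm_smul, Real.norm_eq_abs, abs_of_nonneg hs.1]
    exact ENNReal.ofReal_le_ofReal (mul_le_of_le_one_left (norm_nonneg _) hs.2)
  · obtain ⟨f, a, hf, rfl, hN⟩ := hM.exists_isLocalParam hx
    exact hf.exists_infDist_add_smul ((hN v).1 h.1)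

theorem proj_add_of_mem_normalDisc (hM : IsEmbeddedSubmanifold n M)
    (hclosed : IsClosed M) (hπ : IsNearestPointProj M (tube M r) π)
    {x v : EuclideanSpace ℝ (Fin N)} (h : (x, v) ∈ normalDisc n M r) : π (x + v) = x := by
  obtain ⟨hx, -⟩ := h.1
  refine (hπ.eq_of_dist_eq _ (add_mem_tube (q := (x, v)) h) x hx ?_).symm
  simp [infDist_add_eq_norm_of_mem_normalDisc hM hclosed hπ h]

theorem proj_mem_normalDisc (hM : IsEmbeddedSubmanifold n M)
    (hπ : IsNearestPointProj M (tube M r) π)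
    {p : EuclideanSpace ℝ (Fin N)} (hp : p ∈ tube M r) : (π p, p - π p) ∈ normalDisc n M r := by
  constructor
  · obtain ⟨f, a, hf, hfa, hN⟩ := hM.exists_isLocalParam (hπ.mem p)
    refine (hN _).2 fun u => ?_
    have := hf.inner_fderiv_eq_zero.self_of_nhds p fun y hy => by
      rw [hfa, ← dist_eq_norm, ← dist_eq_norm, dist_comm, hπ.dist_eq, dist_comm]
      exact infDist_le_dist_of_mem hy
    have hu := congr($this u)
    rw [hfa] at hu
    rw [real_inner_comm, ← neg_sub, inner_neg_left, neg_eq_zero]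
    exact hu
  · have : ‖p - π p‖ₑ = infEDist p M := by
      rw [← ofReal_norm, ← dist_eq_norm, hπ.dist_eq, infDist,
        ENNReal.ofReal_toReal (infEDist_ne_top ⟨_, hπ.mem p⟩)]
    exact this.trans_lt hp

/-- Since `‖v‖ₑ < r` is strict, `s • v` is still admissible for some `s > 1`; this overshoot gives
the nondegenerate Hessian. -/
theorem contDiffAt_proj (hM : IsEmbeddedSubmanifold n M)
    (hclosed : IsClosed M) (hπ : IsNearestPointProj M (tube M r) π)
    {x v : EuclideanSpace ℝ (Fin N)} (h : (x, v) ∈ normalDisc n M r) :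
    ContDiffAt ℝ ∞ π (x + v) := by
  obtain ⟨hx, -⟩ := h.1
  have hcont : Continuous fun s : ℝ => ‖s • v‖ₑ := by fun_prop
  have hev : ∀ᶠ s in 𝓝[>] (1 : ℝ), ‖s • v‖ₑ < r :=
    nhdsWithin_le_nhds (hcont.continuousAt.eventually (gt_mem_nhds (by simpa using h.2)))
  obtain ⟨s, hsr, hs⟩ := (hev.and self_mem_nhdsWithin).exists
  have hs : 1 < s := hs
  have hd := infDist_add_eq_norm_of_mem_normalDisc hM hclosed hπ (smul_mem_normalDisc h hsr)
  rw [norm_smul, Real.norm_eq_abs, abs_of_pos (by linarith)] at hd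
  obtain ⟨f, a, hf, rfl, -⟩ := hM.exists_isLocalParam hx
  exact hf.contDiffAt_proj hπ hclosed hs hd (add_mem_tube (q := (f a, v)) h)
    (proj_add_of_mem_normalDisc hM hclosed hπ h)

/-- The endpoint map from the normal vectors shorter than the reach has a smooth inverse. -/
theorem exists_contDiffOn_inverse (hM : IsEmbeddedSubmanifold n M) (hclosed : IsClosed M) :
    ∃ s : EuclideanSpace ℝ (Fin N) → EuclideanSpace ℝ (Fin N) × EuclideanSpace ℝ (Fin N),
      ContDiffOn ℝ ∞ s (tube M (reach M)) ∧
      (∀ p ∈ tube M (reach M), s p ∈ normalDisc n M (reach M) ∧ (s p).1 + (s p).2 = p) ∧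
      ∀ q ∈ normalDisc n M (reach M), s (q.1 + q.2) = q := by
  rcases M.eq_empty_or_nonempty with hemp | hne
  · have h0 : ∀ p, p ∉ tube M (reach M) := fun p hp => by
      have hp : infEDist p M < reach M := hp
      rw [hemp, infEDist_empty] at hp
      exact not_top_lt hp
    exact ⟨0, fun p hp => (h0 p hp).elim, fun p hp => (h0 p hp).elim,
      fun q hq => (h0 _ (add_mem_tube hq)).elim⟩
  obtain ⟨π, hπ⟩ := exists_isNearestPointProj hne hclosed
  refine ⟨fun p => (π p, p - π p), fun p hp => ?_, fun p hp => ⟨proj_mem_normalDisc hM hπ hp,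
    by simp⟩, fun q hq => ?_⟩
  · have := contDiffAt_proj hM hclosed hπ (proj_mem_normalDisc hM hπ hp)
    rw [add_sub_cancel] at this
    exact (this.prodMk (contDiffAt_id.sub this)).contDiffWithinAt
  · have := proj_add_of_mem_normalDisc hM hclosed hπ (x := q.1) (v := q.2) hq
    simp [this]

end Endpoint
-- Submanifold structure on the disc bundle and the diffeomorphism
section AddGraph

variable {E : Type*} [NormedAddCommGroup E] [NormedSpace ℝ E] {U : TopologicalSpace.Opens E}
  {V : Set (E × E)} {s : E → E × E}

/-- `s` is a smooth inverse of the addition map `V → U`. -/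
structure IsAddInverse (U : TopologicalSpace.Opens E) (V : Set (E × E)) (s : E → E × E) :
    Prop where
  contDiffOn : ContDiffOn ℝ ∞ s U
  mem : ∀ p ∈ U, s p ∈ V
  add_eq : ∀ p ∈ U, (s p).1 + (s p).2 = p
  add_mem : ∀ q ∈ V, q.1 + q.2 ∈ U
  apply_add : ∀ q ∈ V, s (q.1 + q.2) = q

/-- Addition as a homeomorphism from `V` to `U`. -/
def IsAddInverse.homeomorph (h : IsAddInverse U V s) : V ≃ₜ U where
  toFun q := ⟨q.1.1 + q.1.2, h.add_mem q.1 q.2⟩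
  invFun p := ⟨s p, h.mem p p.2⟩
  left_inv q := Subtype.ext (h.apply_add q.1 q.2)
  right_inv p := Subtype.ext (h.add_eq p p.2)
  continuous_toFun := by fun_prop
  continuous_invFun :=
    (continuousOn_iff_continuous_domRestrict.1 h.contDiffOn.continuousOn).subtype_mk _

theorem IsAddInverse.isOpenEmbedding (h : IsAddInverse U V s) :
    Topology.IsOpenEmbedding fun q : V => q.1.1 + q.1.2 :=
  U.isOpenEmbedding'.comp h.homeomorph.isOpenEmbedding

/-- The chart of `E × E` straightening `V` to `E × {0}`. -/
def IsAddInverse.straightening (h : IsAddInverse U V s) : OpenPartialHomeomorph (E × E) (E × E) where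
  -- On each fibre of addition this is a translation in `z.1`. Where the sum lies in `U`, the second
  -- coordinate vanishes exactly on `V`.
  toFun z := (z.1 + z.2, z.1 - (s (z.1 + z.2)).1)
  invFun z := (z.2 + (s z.1).1, z.1 - (z.2 + (s z.1).1))
  source := {z | z.1 + z.2 ∈ U}
  target := {z | z.1 ∈ U}
  map_source' z hz := hz
  map_target' z hz := by simpa using hz
  left_inv' z hz := by simp
  right_inv' z hz := by simp
  open_source := U.isOpen.preimage (by fun_prop)
  open_target := U.isOpen.preimage (by fun_prop)
  continuousOn_toFun := by
    have : ContinuousOn (fun z : E × E => s (z.1 + z.2)) {z | z.1 + z.2 ∈ U} :=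
      h.contDiffOn.continuousOn.comp (by fun_prop) fun z hz => hz
    exact ContinuousOn.prodMk (by fun_prop) (continuousOn_fst.sub this.fst)
  continuousOn_invFun := by
    have : ContinuousOn (fun z : E × E => s z.1) {z | z.1 ∈ U} :=
      h.contDiffOn.continuousOn.comp (by fun_prop) fun z hz => hz
    have h2 := continuousOn_snd.add this.fst
    exact h2.prodMk (continuousOn_fst.sub h2)

theorem IsAddInverse.straightening_mem_maximalAtlas (h : IsAddInverse U V s) :
    h.straightening ∈ IsManifold.maximalAtlas 𝓘(ℝ, E × E) ∞ (E × E) := by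
  refine (IsManifold.mem_maximalAtlas_iff_contMDiffOn ..).2 ⟨?_, ?_⟩
  · refine ContDiffOn.contMDiffOn ?_
    have : ContDiffOn ℝ ∞ (fun z : E × E => s (z.1 + z.2)) {z | z.1 + z.2 ∈ U} :=
      h.contDiffOn.comp (by fun_prop) fun z hz => hz
    exact ContDiffOn.prodMk (by fun_prop) (contDiffOn_fst.sub this.fst)
  · refine ContDiffOn.contMDiffOn ?_
    have : ContDiffOn ℝ ∞ (fun z : E × E => s z.1) {z | z.1 ∈ U} :=
      h.contDiffOn.comp (by fun_prop) fun z hz => hz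
    have h2 := contDiffOn_snd.add this.fst
    exact h2.prodMk (contDiffOn_fst.sub h2)

/-- For the smooth structure transported from `U`, the inclusion `V → E × E` is an immersion. -/
theorem IsAddInverse.isImmersion [Nonempty V] (h : IsAddInverse U V s) :
    letI := h.isOpenEmbedding.singletonChartedSpace
    Manifold.IsImmersion 𝓘(ℝ, E) 𝓘(ℝ, E × E) ∞ (Subtype.val : V → E × E) := by
  let _ := h.isOpenEmbedding.singletonChartedSpace
  have : IsManifold 𝓘(ℝ, E) ∞ V := h.isOpenEmbedding.isManifold_singleton
  refine Manifold.IsImmersionOfComplement.isImmersion (F := E) fun x => ?_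
  refine Manifold.IsImmersionAtOfComplement.mk_of_continuousAt continuous_subtype_val.continuousAt
    (.refl ℝ (E × E)) (chartAt E x) h.straightening (mem_chart_source E x) (h.add_mem x.1 x.2)
    (IsManifold.chart_mem_maximalAtlas x) h.straightening_mem_maximalAtlas fun y hy => ?_
  obtain ⟨q, hq, rfl⟩ : ∃ q ∈ (chartAt E x).source, chartAt E x q = y :=
    ⟨(chartAt E x).symm y, (chartAt E x).map_target (by simpa using hy),
      (chartAt E x).right_inv (by simpa using hy)⟩
  have e : chartAt E x q = q.1.1 + q.1.2 := by
    rw [h.isOpenEmbedding.singletonChartedSpace_chartAt_eq]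
  change h.straightening ((chartAt E x).symm (chartAt E x q)).1 = (chartAt E x q, 0)
  rw [(chartAt E x).left_inv hq, e]
  change (q.1.1 + q.1.2, q.1.1 - (s (q.1.1 + q.1.2)).1) = (q.1.1 + q.1.2, 0)
  rw [h.apply_add q.1 q.2, sub_self]

/-- For any smooth structure on `V` for which the inclusion `V → E × E` is an immersion, addition
is a diffeomorphism from `V` to `U`. -/
def IsAddInverse.diffeomorph [ChartedSpace E V] (h : IsAddInverse U V s)
    (hV : Manifold.IsImmersion 𝓘(ℝ, E) 𝓘(ℝ, E × E) ∞ (Subtype.val : V → E × E)) :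
    Diffeomorph 𝓘(ℝ, E) 𝓘(ℝ, E) V U ∞ where
  toEquiv := h.homeomorph.toEquiv
  contMDiff_toFun := by
    refine (ContMDiff.subtypeVal_comp_iff U _).1 ?_
    have : ContDiff ℝ ∞ fun z : E × E => z.1 + z.2 := by fun_prop
    exact this.contMDiff.comp hV.contMDiff
  contMDiff_invFun := by
    -- A continuous map into `V` is smooth once its composite with the immersion into `E × E` is;
    -- here the composite is `s`.
    refine (ContMDiff.iff_comp_isImmersion hV).2 ⟨h.homeomorph.symm.continuous, ?_⟩
    exact h.contDiffOn.contMDiffOn.comp_contMDiff contMDiff_subtype_val fun p => p.2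

end AddGraph

theorem exists_isAddInverse {n N : ℕ} {M : Set (EuclideanSpace ℝ (Fin N))}
    [ChartedSpace (EuclideanSpace ℝ (Fin n)) M]
    (hM : IsEmbeddedSubmanifold n M) (hclosed : IsClosed M) :
    ∃ s, IsAddInverse (tube M (reach M)) (normalDisc n M (reach M)) s := by
  obtain ⟨s, hs, hsU, hsV⟩ := exists_contDiffOn_inverse hM hclosed
  exact ⟨s, hs, fun p hp => (hsU p hp).1, fun p hp => (hsU p hp).2, fun q hq => add_mem_tube hq, hsV⟩

end QuantTube

theorem theoremB1 (n N : ℕ) (M : Set (EuclideanSpace ℝ (Fin N)))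
    [ChartedSpace (EuclideanSpace ℝ (Fin n)) M]
    (hM : QuantTube.IsEmbeddedSubmanifold n M) (hclosed : IsClosed M) :
    -- the normal vectors shorter than the reach form an `N`-dimensional embedded submanifold
    (∃ _ : ChartedSpace (EuclideanSpace ℝ (Fin N))
        (QuantTube.normalDisc n M (QuantTube.reach M)),
      QuantTube.IsEmbeddedSubmanifold N (QuantTube.normalDisc n M (QuantTube.reach M))) ∧
    -- for the smooth structure of that embedded submanifold, the endpoint map is a diffeomorphism
    ∀ [ChartedSpace (EuclideanSpace ℝ (Fin N)) (QuantTube.normalDisc n M (QuantTube.reach M))],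
      QuantTube.IsEmbeddedSubmanifold N (QuantTube.normalDisc n M (QuantTube.reach M)) →
      ∃ Φ : Diffeomorph (𝓡 N) (𝓡 N) (QuantTube.normalDisc n M (QuantTube.reach M))
          (QuantTube.tube M (QuantTube.reach M)) ∞,
        ⇑Φ = QuantTube.endpointMap n M (QuantTube.reach M) := by
  obtain ⟨s, hs⟩ := QuantTube.exists_isAddInverse hM hclosed
  refine ⟨?_, fun hV => ⟨hs.diffeomorph hV.isSmoothEmbedding.isImmersion, rfl⟩⟩
  -- The transported single-chart structure is used for a nonempty disc bundle; the empty one gets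
  -- the empty atlas, with an arbitrary complement.
  rcases isEmpty_or_nonempty (QuantTube.normalDisc n M (QuantTube.reach M)) with hemp | hne
  · let _ := ChartedSpace.empty (EuclideanSpace ℝ (Fin N))
      (QuantTube.normalDisc n M (QuantTube.reach M))
    exact ⟨inferInstance, .empty _,
      Manifold.IsImmersionOfComplement.isImmersion (F := PUnit.{1}) fun x => isEmptyElim x,
      Topology.IsEmbedding.subtypeVal⟩
  · let _ := hs.isOpenEmbedding.singletonChartedSpace
    exact ⟨inferInstance, hs.isOpenEmbedding.isManifold_singleton, hs.isImmersion,
      Topology.IsEmbedding.subtypeVal⟩
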